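/- Let $(X,d)$ be a compact metric space and $T:X\to X$ a homeomorphism such that $(X,T)$ is totally uniquely ergodic: for every integer $m\ge 1$ there is exactly one $T^m$-invariant Borel probability measure on $X$. Let $\mu$ be the unique $T$-invariant Borel probability measure. Fix an integer $C\ge 2$ and $k\in\mathbb N$, and suppose that for some strictly increasing sequence $(q_n)$ of natural numbers \[ \max_{0\le t<q_n}\ \sup_{x\in X} d\bigl(x,T^{tq_n}x\bigr)\longrightarrow 0\qquad (n\to\infty). \] For integers $n\ge 1$ and $i\ge 0$ let \[ \mathrm{Pow}_n(i)=\bigl|\{t\in\{1,\dots,n\}: t^C\equiv i \pmod n\}\bigr|, \] and let $\omega(n)$ be the number of distinct prime divisors of $n$. Then for every continuous $f:X\to\mathbb C$, \[ \lim_{\substack{n\to\infty\\ \omega(n)\le k}}\ \frac1n\sum_{0\le i<n}\mathrm{Pow}_n(i)\,f(T^i x)=\int_X f\,d\mu \] uniformly in $x\in X$; that is, for every $\varepsilon>0$ there is $N_0$ such that for all $n\ge N_0$ with $\omega(n)\le k$ and all $x\in X$ the average on the left differs from $\int_X f\,d\mu$ by less than $\varepsilon$. -/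

import Mathlib

open MeasureTheory Filter Topology

namespace PowerOrbit

/-- A measurable self-map `T` is uniquely ergodic if it preserves exactly one Borel probability
measure. -/
def UniquelyErgodic {X : Type*} [MeasurableSpace X] (T : X → X) : Prop :=
  ∃! μ : Measure X, IsProbabilityMeasure μ ∧ MeasurePreserving T μ μ

/-- `T` is totally uniquely ergodic if all its positive powers are uniquely ergodic. -/
def TotallyUniquelyErgodic {X : Type*} [MeasurableSpace X] (T : X → X) : Prop :=
  ∀ m : ℕ, 1 ≤ m → UniquelyErgodic (T^[m])

/-- The quantity `max_{t < q} sup_{x ∈ X} d(x, T^{t q} x)`. On a compact metric space the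
distances are bounded, so these are genuine suprema. -/
noncomputable def rigidityDefect {X : Type*} [MetricSpace X] (T : X → X) (q : ℕ) : ℝ :=
  ⨆ t : Fin q, ⨆ x : X, dist x (T^[(t : ℕ) * q] x)

/-- `powCount C N x` is the number of `t ∈ [1, N]` such that `t ^ C ≡ x (mod N)`. -/
def powCount (C N x : ℕ) : ℕ :=
  ((Finset.Icc 1 N).filter (fun t => t ^ C ≡ x [MOD N])).card

end PowerOrbit

/-! Subtract the mean, so that `∫ f = 0`, and put F(i) = f(T^i x). The sum becomes ∑ F(t^C) over t
mod n. The weights `powCount` need not be bounded (for n = p², about p residues have C-th power 0),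
so t is restricted to gcd(t, n) ≤ B = L^k. Since n has at most k prime factors, this discards at
most kn/L residues. The remaining weight Φ is bounded by a constant K independent of n, and Φ(u^C i)
= Φ(i) for every unit u.

Expand Φ in characters of ℤ/n. Frequencies of additive order at most R form a bounded R!-periodic
weight, and total unique ergodicity makes its correlation with the orbit o(n), uniformly in x.

For the high frequencies, average over the shifts sq, s < q, with q a rigidity time. The orbit
hardly changes, so F may be treated as invariant. The shifts multiply the Fourier coefficients by a
kernel; as the coefficients are constant along c ↦ u^C c, only the mean square of the kernel over
such orbits matters. Square-root cancellation in ∑_u e(u^C c / n) lowers it from the trivial q² to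
2q, and Cauchy–Schwarz concludes.

The cancellation is elementary: a second moment is compared with the number of frequencies at which
the sum takes the same absolute value (`norm_sq_unitPowSum_le`); it needs few C-th roots of unity,
which is where ω(n) ≤ k enters again. Constants are fixed in the order L, K, η, q, R, and only then
n → ∞. -/

open scoped ENNReal

/-! ### Uniform convergence of Birkhoff averages, plain and with periodic weights. -/

namespace PowerOrbit

/-- The empirical measure of the first `N` points of the `S`-orbit of `x`. -/
noncomputable def empiricalMeasure {X : Type*} [MeasurableSpace X] (S : X → X) (N : ℕ) (x : X) :
    Measure X :=
  (N : ℝ≥0∞)⁻¹ • ∑ j ∈ Finset.range N, Measure.dirac (S^[j] x)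

lemma isProbabilityMeasure_empiricalMeasure {X : Type*} [MeasurableSpace X] (S : X → X) {N : ℕ}
    (hN : N ≠ 0) (x : X) : IsProbabilityMeasure (empiricalMeasure S N x) := by
  constructor
  simp only [empiricalMeasure, Measure.smul_apply, Measure.finsetSum_apply, measure_univ,
    Finset.sum_const, Finset.card_range, nsmul_eq_mul, mul_one, smul_eq_mul]
  exact ENNReal.inv_mul_cancel (by simpa using hN) (by simp)

lemma integral_empiricalMeasure {X E : Type*} [TopologicalSpace X] [MeasurableSpace X]
    [MeasurableSingletonClass X] [NormedAddCommGroup E] [NormedSpace ℝ E] [CompleteSpace E]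
    (S : X → X) (N : ℕ) (x : X) (g : X → E) :
    ∫ y, g y ∂(empiricalMeasure S N x) = (N : ℝ)⁻¹ • ∑ j ∈ Finset.range N, g (S^[j] x) := by
  rw [empiricalMeasure, integral_smul_measure, integral_finsetSum_measure]
  · simp
  · intro i _
    exact integrable_dirac (by simp [enorm])

section UniqueErgodicity

variable {X : Type*} [MetricSpace X] [CompactSpace X] [MeasurableSpace X] [BorelSpace X]

/-- A limit of empirical measures along longer and longer orbit segments is invariant. -/
lemma measurePreserving_of_tendsto_empiricalMeasure {S : X → X} (hS : Continuous S)
    {U : Filter ℕ} [U.NeBot] (hU : U ≤ atTop) (x : ℕ → X) (κ : ℕ → ProbabilityMeasure X)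
    (hκ : ∀ᶠ N in U, (κ N : Measure X) = empiricalMeasure S N (x N))
    (ν : ProbabilityMeasure X) (hν : Tendsto κ U (𝓝 ν)) :
    MeasurePreserving S (ν : Measure X) ν := by
  refine ⟨hS.measurable, ?_⟩
  have : IsProbabilityMeasure ((ν : Measure X).map S) :=
    Measure.isProbabilityMeasure_map hS.measurable.aemeasurable
  refine ext_of_forall_integral_eq_of_IsFiniteMeasure fun g => ?_
  rw [integral_map hS.measurable.aemeasurable g.continuous.aestronglyMeasurable]
  have h := ProbabilityMeasure.tendsto_iff_forall_integral_tendsto.1 hν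
  have h1 := h g
  have h2 := h (g.compContinuous ⟨S, hS⟩)
  simp only [BoundedContinuousFunction.compContinuous_apply, ContinuousMap.coe_mk] at h2
  refine tendsto_nhds_unique h2 ?_
  have h3 : Tendsto (fun N : ℕ => (N : ℝ)⁻¹ * (2 * ‖g‖)) U (𝓝 0) := by
    have := (tendsto_inv_atTop_nhds_zero_nat (𝕜 := ℝ)).mul_const (2 * ‖g‖)
    rw [zero_mul] at this
    exact this.mono_left hU
  have h4 : Tendsto (fun N => ∫ y, g (S y) ∂(κ N : Measure X) - ∫ y, g y ∂(κ N : Measure X))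
      U (𝓝 0) := by
    refine squeeze_zero_norm' ?_ h3
    filter_upwards [hκ] with N hN
    rw [hN, integral_empiricalMeasure, integral_empiricalMeasure, ← smul_sub,
      ← Finset.sum_sub_distrib]
    have : ∀ j, g (S (S^[j] (x N))) - g (S^[j] (x N))
        = (fun j => g (S^[j] (x N))) (j + 1) - (fun j => g (S^[j] (x N))) j := by
      intro j
      simp only [Function.iterate_succ_apply']
    rw [Finset.sum_congr rfl fun j _ => this j, Finset.sum_range_sub (fun j => g (S^[j] (x N))), norm_smul, norm_inv,
      Real.norm_natCast]
    gcongr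
    calc _ ≤ ‖g (S^[N] (x N))‖ + ‖g (S^[0] (x N))‖ := norm_sub_le _ _
      _ ≤ ‖g‖ + ‖g‖ := add_le_add (g.norm_coe_le_norm _) (g.norm_coe_le_norm _)
      _ = _ := by ring
  simpa using h4.add h1

/-- For a uniquely ergodic system, Birkhoff averages of continuous functions converge uniformly. -/
theorem UniquelyErgodic.eventually_norm_birkhoff_le {S : X → X} (hS : Continuous S)
    (hE : UniquelyErgodic S) (μ : Measure X) [IsProbabilityMeasure μ]
    (hμ : MeasurePreserving S μ μ) (f : C(X, ℂ)) (hf : ∫ y, f y ∂μ = 0) {ε : ℝ} (hε : 0 < ε) :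
    ∀ᶠ N : ℕ in atTop, ∀ x : X, ‖∑ j ∈ Finset.range N, f (S^[j] x)‖ ≤ ε * N := by
  by_contra hcon
  rw [not_eventually] at hcon
  push Not at hcon
  obtain ⟨z, hz⟩ : ∃ z : ℕ → X, ∀ N, (∃ x, ε * N < ‖∑ j ∈ Finset.range N, f (S^[j] x)‖) →
      ε * N < ‖∑ j ∈ Finset.range N, f (S^[j] (z N))‖ := by
    have := nonempty_of_isProbabilityMeasure μ
    refine ⟨fun N => Classical.epsilon fun x => ε * N < ‖∑ j ∈ Finset.range N, f (S^[j] x)‖, ?_⟩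
    intro N hN
    exact Classical.epsilon_spec hN
  have hne : (atTop ⊓ 𝓟 {N : ℕ | ∃ x, ε * N < ‖∑ j ∈ Finset.range N, f (S^[j] x)‖}).NeBot :=
    frequently_mem_iff_neBot.1 hcon
  -- An ultrafilter on the bad times plays the role of a convergent subsequence: by compactness of
  -- the space of probability measures, the empirical measures converge along it.
  set U := Ultrafilter.of (atTop ⊓ 𝓟 {N : ℕ | ∃ x, ε * N < ‖∑ j ∈ Finset.range N, f (S^[j] x)‖})
  have hU : (U : Filter ℕ) ≤ _ := Ultrafilter.of_le _
  have hUtop : (U : Filter ℕ) ≤ atTop := hU.trans inf_le_left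
  have hUbad : ∀ᶠ N in (U : Filter ℕ), ε * N < ‖∑ j ∈ Finset.range N, f (S^[j] (z N))‖ := by
    have : ∀ᶠ N in 𝓟 {N : ℕ | ∃ x, ε * N < ‖∑ j ∈ Finset.range N, f (S^[j] x)‖},
        ε * N < ‖∑ j ∈ Finset.range N, f (S^[j] (z N))‖ :=
      eventually_principal.2 fun N hN => hz N hN
    exact (hU.trans inf_le_right) this
  let κ : ℕ → ProbabilityMeasure X := fun N =>
    -- The empirical measure of an empty segment is not a probability measure; `μ` is a dummy value
    -- there.
    if h : N = 0 then ⟨μ, inferInstance⟩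
    else ⟨empiricalMeasure S N (z N), isProbabilityMeasure_empiricalMeasure S h _⟩
  have hpos : ∀ᶠ N : ℕ in (U : Filter ℕ), N ≠ 0 := hUtop (eventually_ne_atTop 0)
  have hκ : ∀ᶠ N in (U : Filter ℕ), (κ N : Measure X) = empiricalMeasure S N (z N) := by
    filter_upwards [hpos] with N hN
    simp [κ, hN]
  obtain ⟨ν, hν⟩ : ∃ ν, Tendsto κ U (𝓝 ν) :=
    ⟨(U.map κ).lim, (U.map κ).le_nhds_lim⟩
  have hinv := measurePreserving_of_tendsto_empiricalMeasure hS hUtop z κ hκ ν hν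
  have heq : (ν : Measure X) = μ := hE.unique ⟨inferInstance, hinv⟩ ⟨inferInstance, hμ⟩
  have hlim := (ProbabilityMeasure.tendsto_iff_forall_integral_rclike_tendsto ℂ).1 hν
    (BoundedContinuousFunction.mkOfCompact f)
  simp only [BoundedContinuousFunction.mkOfCompact_apply, heq, hf] at hlim
  have hlt : ∀ᶠ N in (U : Filter ℕ), ‖∫ y, f y ∂(κ N : Measure X)‖ < ε := by
    have := hlim.norm
    rw [norm_zero] at this
    exact this.eventually_lt_const hε
  obtain ⟨N, hN0, hN1, hN2, hN3⟩ := (hpos.and (hκ.and (hUbad.and hlt))).exists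
  rw [hN1, integral_empiricalMeasure, norm_smul, norm_inv, Real.norm_natCast] at hN3
  have hNpos : (0 : ℝ) < N := by exact_mod_cast Nat.pos_of_ne_zero hN0
  rw [inv_mul_lt_iff₀ hNpos] at hN3
  linarith [mul_comm ε (N : ℝ)]

end UniqueErgodicity

lemma sum_range_mul_eq_sum_sum {E : Type*} [AddCommMonoid E] (g : ℕ → E) (M N : ℕ) :
    ∑ i ∈ Finset.range (M * N), g i
      = ∑ r ∈ Finset.range M, ∑ j ∈ Finset.range N, g (M * j + r) := by
  induction N with
  | zero => simp
  | succ N ih =>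
    rw [Nat.mul_succ, Finset.sum_range_add, ih, ← Finset.sum_add_distrib]
    exact Finset.sum_congr rfl fun r _ => (Finset.sum_range_succ _ _).symm

/-- In a totally uniquely ergodic system, orbit sums with periodic weights converge uniformly. -/
theorem TotallyUniquelyErgodic.eventually_norm_periodic_sum_le {X : Type*} [MetricSpace X]
    [CompactSpace X] [MeasurableSpace X] [BorelSpace X] {T : X → X} (hT : Continuous T)
    (hE : TotallyUniquelyErgodic T) (μ : Measure X) [IsProbabilityMeasure μ]
    (hμ : MeasurePreserving T μ μ) (f : C(X, ℂ)) (hf : ∫ y, f y ∂μ = 0) {M : ℕ} (hM : 0 < M)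
    {W ε : ℝ} (hW : 0 < W) (hε : 0 < ε) :
    ∀ᶠ n : ℕ in atTop, ∀ x : X, ∀ φ : ℕ → ℂ, (∀ i, φ (i + M) = φ i) → (∀ i, ‖φ i‖ ≤ W) →
      ‖∑ i ∈ Finset.range n, φ i * f (T^[i] x)‖ ≤ ε * n := by
  -- Half of ε pays for the complete blocks of length M, on which each residue class is an orbit of
  -- T^M; the other half pays for the fewer than M leftover terms.
  have hδ : 0 < ε / (2 * W) := by positivity
  have h1 := (hE M hM).eventually_norm_birkhoff_le (hT.iterate M) μ (hμ.iterate M) f hf hδ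
  have h2 := (Nat.tendsto_div_const_atTop hM.ne').eventually h1
  have h3 : ∀ᶠ n : ℕ in atTop, M * (W * ‖f‖) ≤ ε / 2 * n := by
    have := (tendsto_natCast_atTop_atTop (R := ℝ)).const_mul_atTop (half_pos hε)
    exact this.eventually_ge_atTop _
  filter_upwards [h2, h3] with n hn2 hn3 x φ hφ hφW
  have hper : ∀ j r, φ (M * j + r) = φ r := by
    intro j r
    induction j with
    | zero => simp
    | succ j ih => rw [Nat.mul_succ, add_right_comm, hφ, ih]
  conv_lhs => rw [← Nat.div_add_mod n M]
  rw [Finset.sum_range_add, sum_range_mul_eq_sum_sum]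
  have hA : ∀ r ∈ Finset.range M,
      ‖∑ j ∈ Finset.range (n / M), φ (M * j + r) * f (T^[M * j + r] x)‖
        ≤ W * (ε / (2 * W) * (n / M : ℕ)) := by
    intro r _
    have : ∀ j, φ (M * j + r) * f (T^[M * j + r] x) = φ r * f ((T^[M])^[j] (T^[r] x)) := by
      intro j
      rw [hper, ← Function.iterate_mul, Function.iterate_add_apply]
    simp_rw [this]
    rw [← Finset.mul_sum, norm_mul]
    exact mul_le_mul (hφW r) (hn2 _) (norm_nonneg _) hW.le
  have hB : ‖∑ i ∈ Finset.range (n % M), φ (M * (n / M) + i) * f (T^[M * (n / M) + i] x)‖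
      ≤ M * (W * ‖f‖) := by
    refine (norm_sum_le_of_le _ (f := fun i => φ (M * (n / M) + i) * f (T^[M * (n / M) + i] x))
      (n := fun _ => W * ‖f‖) fun i _ => ?_).trans ?_
    · rw [norm_mul]
      exact mul_le_mul (hφW _) (f.norm_coe_le_norm _) (norm_nonneg _) hW.le
    · rw [Finset.sum_const, Finset.card_range, nsmul_eq_mul]
      gcongr
      exact (Nat.mod_lt n hM).le
  have hdm : ((M : ℝ) * (n / M : ℕ)) ≤ n := by exact_mod_cast Nat.mul_div_le n M
  calc _ ≤ ‖∑ r ∈ Finset.range M, ∑ j ∈ Finset.range (n / M),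
          φ (M * j + r) * f (T^[M * j + r] x)‖ + M * (W * ‖f‖) :=
        (norm_add_le _ _).trans (by gcongr)
    _ ≤ M * (W * (ε / (2 * W) * (n / M : ℕ))) + M * (W * ‖f‖) := by
        gcongr
        refine (norm_sum_le_of_le _ hA).trans ?_
        simp
    _ = ε / 2 * (M * (n / M : ℕ)) + M * (W * ‖f‖) := by
        field_simp
    _ ≤ ε / 2 * n + ε / 2 * n := by gcongr
    _ = ε * n := by ring

end PowerOrbit

/-! ### Roots of unity modulo n, and the size of the totient. -/

namespace PowerOrbit

/-- The number of `C`-th roots of unity modulo `n`. -/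
noncomputable def rootCount (C n : ℕ) : ℕ := Nat.card {u : (ZMod n)ˣ // u ^ C = 1}

lemma card_roots_le_of_isCyclic {G : Type*} [Group G] [Finite G] [IsCyclic G] {C : ℕ}
    (hC : 0 < C) : Nat.card {u : G // u ^ C = 1} ≤ C := by
  classical
  have := Fintype.ofFinite G
  rw [Nat.card_eq_fintype_card, Fintype.card_subtype]
  exact IsCyclic.card_pow_eq_one_le hC

/-- A finite commutative group with a cyclic subgroup of index two has few `C`-th roots of `1`. -/
lemma card_roots_le_of_card_le {G : Type*} [CommGroup G] [Finite G] (g : G)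
    (hg : Nat.card G ≤ 2 * orderOf g) {C : ℕ} (hC : 0 < C) :
    Nat.card {u : G // u ^ C = 1} ≤ 2 * C := by
  set K : Subgroup G := (powMonoidHom C : G →* G).ker
  set Z := Subgroup.zpowers g
  have hK : Nat.card {u : G // u ^ C = 1} = Nat.card K := Nat.card_congr (Equiv.refl _)
  have hZ : Z.index ≤ 2 := by
    have h1 := Z.card_mul_index
    rw [Nat.card_zpowers] at h1
    have h2 := orderOf_pos g
    nlinarith
  -- The roots of unity K meet Z in a subgroup of index at most 2, and that subgroup has at most C
  -- elements because Z is cyclic.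
  have h1 : Z.relIndex K ≤ 2 :=
    (Nat.le_of_dvd (Nat.pos_of_ne_zero Subgroup.index_ne_zero_of_finite)
      (Subgroup.relIndex_dvd_index_of_normal Z K)).trans hZ
  have h2 : Nat.card (Z.subgroupOf K) ≤ C := by
    refine le_trans ?_ (card_roots_le_of_isCyclic (G := Z) hC)
    refine Nat.card_le_card_of_injective
      (fun x : Z.subgroupOf K => (⟨⟨x.1.1, x.2⟩, ?_⟩ : {u : Z // u ^ C = 1})) ?_
    · ext
      exact x.1.2
    · intro x y hxy
      exact Subtype.ext (Subtype.ext (congrArg (fun z => ((z.1 : Z) : G)) hxy))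
  rw [hK, ← (Z.subgroupOf K).card_mul_index]
  calc _ ≤ C * 2 := Nat.mul_le_mul h2 h1
    _ = 2 * C := mul_comm _ _

/-- The unit group is cyclic for odd p and for 2^a with a ≤ 2. For larger powers of 2, the residue 5
generates a subgroup of index 2, hence the factor 2. -/
lemma rootCount_prime_pow_le {C p : ℕ} (hC : 0 < C) (hp : p.Prime) (a : ℕ) :
    rootCount C (p ^ a) ≤ 2 * C := by
  have : NeZero (p ^ a) := ⟨pow_ne_zero _ hp.ne_zero⟩
  by_cases h2 : p = 2
  · subst h2
    by_cases ha : a ≤ 2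
    · have := (ZMod.isCyclic_units_two_pow_iff a).2 ha
      exact (card_roots_le_of_isCyclic hC).trans (by lia)
    · obtain ⟨b, rfl⟩ : ∃ b, a = b + 2 := ⟨a - 2, by lia⟩
      have ho := ZMod.orderOf_five b
      have hunit : IsUnit (5 : ZMod (2 ^ (b + 2))) := by
        have := (ZMod.isUnit_iff_coprime 5 (2 ^ (b + 2))).2 (Nat.Coprime.pow_right _ (by norm_num))
        exact_mod_cast this
      refine card_roots_le_of_card_le hunit.unit ?_ hC
      rw [← orderOf_units, IsUnit.unit_spec, ho, Nat.card_eq_fintype_card, ZMod.card_units_eq_totient,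
        Nat.totient_prime_pow_succ Nat.prime_two]
      simp [pow_succ, mul_comm]
  · have := ZMod.isCyclic_units_of_prime_pow p hp h2 a
    exact (card_roots_le_of_isCyclic hC).trans (by lia)

lemma rootCount_mul {C m n : ℕ} (h : m.Coprime n) :
    rootCount C (m * n) = rootCount C m * rootCount C n := by
  rw [rootCount, rootCount, rootCount, ← Nat.card_prod]
  let e : (ZMod (m * n))ˣ ≃* (ZMod m)ˣ × (ZMod n)ˣ :=
    (Units.mapEquiv (ZMod.chineseRemainder h).toMulEquiv).trans MulEquiv.prodUnits
  refine Nat.card_congr ((Equiv.subtypeEquiv e.toEquiv (q := fun v => v.1 ^ C = 1 ∧ v.2 ^ C = 1)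
    fun u => ?_).trans (Equiv.subtypeProdEquivProd
      (p := fun v : (ZMod m)ˣ => v ^ C = 1) (q := fun v : (ZMod n)ˣ => v ^ C = 1)))
  rw [← e.injective.eq_iff, map_pow, map_one, Prod.ext_iff]
  rfl

open ArithmeticFunction in
theorem rootCount_le {C n : ℕ} (hC : 0 < C) (hn : n ≠ 0) :
    rootCount C n ≤ (2 * C) ^ cardDistinctFactors n := by
  induction n using Nat.recOnPosPrimePosCoprime with
  | prime_pow p a hp ha =>
    rw [cardDistinctFactors_apply_prime_pow hp ha.ne', pow_one]
    exact rootCount_prime_pow_le hC hp a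
  | zero => exact absurd rfl hn
  | one =>
    simpa [rootCount] using Finite.card_subtype_le (fun u : (ZMod 1)ˣ => u ^ C = 1)
  | coprime a b ha hb hab iha ihb =>
    rw [rootCount_mul hab, cardDistinctFactors_mul hab, pow_add]
    exact Nat.mul_le_mul (iha (by lia)) (ihb (by lia))

open ArithmeticFunction in
-- Each factor 1 - 1/p in φ(n)/n is at least 1/2.
theorem le_two_pow_mul_totient {n : ℕ} :
    n ≤ 2 ^ cardDistinctFactors n * n.totient := by
  have h : (2⁻¹ : ℚ) ^ cardDistinctFactors n ≤ ∏ p ∈ n.primeFactors, (1 - (p : ℚ)⁻¹) := by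
    rw [cardDistinctFactors_apply, ← List.card_toFinset, Nat.toFinset_factors]
    rw [← Finset.prod_const]
    refine Finset.prod_le_prod (fun _ _ => by norm_num) fun p hp => ?_
    have : (2 : ℚ) ≤ p := by exact_mod_cast (Nat.prime_of_mem_primeFactors hp).two_le
    have : (p : ℚ)⁻¹ ≤ 2⁻¹ := by gcongr
    linarith
  have h2 : (n : ℚ) * 2⁻¹ ^ cardDistinctFactors n ≤ n.totient := by
    rw [Nat.totient_eq_mul_prod_factors]
    gcongr
  rw [inv_pow, ← div_eq_mul_inv, div_le_iff₀ (by positivity), mul_comm] at h2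
  exact_mod_cast h2

end PowerOrbit

/-! ### Exponential sums over C-th powers of units. -/

namespace PowerOrbit

open ArithmeticFunction in
lemma cardDistinctFactors_eq_card_primeFactors (n : ℕ) :
    cardDistinctFactors n = n.primeFactors.card := by
  rw [cardDistinctFactors_apply, ← List.card_toFinset, Nat.toFinset_factors]

open ArithmeticFunction in
lemma cardDistinctFactors_le_of_dvd {m n : ℕ} (h : m ∣ n) (hn : n ≠ 0) :
    cardDistinctFactors m ≤ cardDistinctFactors n := by
  rw [cardDistinctFactors_eq_card_primeFactors, cardDistinctFactors_eq_card_primeFactors]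
  exact Finset.card_le_card (Nat.primeFactors_mono h hn)

variable {n : ℕ} [NeZero n]

lemma addOrderOf_zmod_dvd (c : ZMod n) : addOrderOf c ∣ n := by
  simpa using addOrderOf_dvd_card (x := c)

/-- The annihilator of c is the kernel of reduction modulo the order of c. This turns equations
multiplied by c into congruences modulo that order. -/
lemma mul_eq_zero_iff_castHom_addOrderOf (x c : ZMod n) :
    x * c = 0 ↔ ZMod.castHom (addOrderOf_zmod_dvd c) (ZMod (addOrderOf c)) x = 0 := by
  conv_lhs => rw [← ZMod.natCast_zmod_val x]
  conv_rhs => rw [← ZMod.natCast_zmod_val x]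
  rw [map_natCast, ZMod.natCast_eq_zero_iff, addOrderOf_dvd_iff_nsmul_eq_zero, nsmul_eq_mul]

lemma mul_eq_self_iff_castHom_addOrderOf (x c : ZMod n) :
    x * c = c ↔ ZMod.castHom (addOrderOf_zmod_dvd c) (ZMod (addOrderOf c)) x = 1 := by
  rw [← sub_eq_zero, ← sub_one_mul, mul_eq_zero_iff_castHom_addOrderOf, map_sub, map_one,
    sub_eq_zero]

lemma le_card_annihilator_mul_addOrderOf (c : ZMod n) :
    n ≤ (Finset.univ.filter fun z : ZMod n => z * c = 0).card * addOrderOf c := by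
  set f := (ZMod.castHom (addOrderOf_zmod_dvd c) (ZMod (addOrderOf c))).toAddMonoidHom
  have h1 := f.ker.card_mul_index
  have hm : NeZero (addOrderOf c) := ⟨(addOrderOf_pos c).ne'⟩
  rw [AddSubgroup.index_ker, Nat.card_zmod] at h1
  have h2 : Nat.card f.ker = (Finset.univ.filter fun z : ZMod n => z * c = 0).card := by
    rw [← Fintype.card_subtype, ← Nat.card_eq_fintype_card]
    exact Nat.card_congr (Equiv.subtypeEquivRight fun z =>
      (mul_eq_zero_iff_castHom_addOrderOf z c).symm)
  have h3 : Nat.card f.range ≤ addOrderOf c := by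
    have := Finite.card_subtype_le (fun x : ZMod (addOrderOf c) => x ∈ f.range)
    rwa [Nat.card_zmod] at this
  calc n = _ := h1.symm
    _ ≤ _ := by rw [h2]; gcongr

/-- The number of units whose `C`-th power fixes `c`. -/
def fixCount (C : ℕ) (c : ZMod n) : ℕ :=
  (Finset.univ.filter fun u : (ZMod n)ˣ => (u : ZMod n) ^ C * c = c).card

/-- The units counted are the preimage, under the surjective reduction to units modulo the order of
c, of the C-th roots of unity there; a preimage keeps its index. -/
lemma fixCount_mul_totient (C : ℕ) (c : ZMod n) :
    fixCount C c * (addOrderOf c).totient = n.totient * rootCount C (addOrderOf c) := by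
  have hm : NeZero (addOrderOf c) := ⟨(addOrderOf_pos c).ne'⟩
  set π := ZMod.unitsMap (addOrderOf_zmod_dvd c)
  set R : Subgroup (ZMod (addOrderOf c))ˣ :=
    (powMonoidHom C : (ZMod (addOrderOf c))ˣ →* (ZMod (addOrderOf c))ˣ).ker
  have hR : rootCount C (addOrderOf c) = Nat.card R := Nat.card_congr (Equiv.refl _)
  have hF : fixCount C c = Nat.card (R.comap π) := by
    rw [fixCount, ← Fintype.card_subtype, ← Nat.card_eq_fintype_card]
    refine Nat.card_congr (Equiv.subtypeEquivRight fun u => ?_)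
    rw [mul_eq_self_iff_castHom_addOrderOf, map_pow, Subgroup.mem_comap, MonoidHom.mem_ker,
      powMonoidHom_apply, Units.ext_iff]
    rfl
  have hi : (R.comap π).index = R.index :=
    R.index_comap_of_surjective (ZMod.unitsMap_surjective _)
  have h1 := R.card_mul_index
  have h2 := (R.comap π).card_mul_index
  rw [Nat.card_eq_fintype_card (α := (ZMod _)ˣ), ZMod.card_units_eq_totient] at h1 h2
  rw [← h1, ← h2, hR, hF, hi]
  ring

open ArithmeticFunction in
theorem fixCount_mul_addOrderOf_le {C k : ℕ} (hC : 0 < C) (hk : cardDistinctFactors n ≤ k)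
    (c : ZMod n) : fixCount C c * addOrderOf c ≤ (4 * C) ^ k * n := by
  have hω := (cardDistinctFactors_le_of_dvd (addOrderOf_zmod_dvd c) (NeZero.ne n)).trans hk
  have h1 : addOrderOf c ≤ 2 ^ k * (addOrderOf c).totient :=
    le_two_pow_mul_totient.trans (by gcongr; norm_num)
  have h2 : rootCount C (addOrderOf c) ≤ (2 * C) ^ k :=
    (rootCount_le hC (addOrderOf_pos c).ne').trans (by gcongr; lia)
  calc fixCount C c * addOrderOf c
      ≤ fixCount C c * (2 ^ k * (addOrderOf c).totient) := by gcongr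
    _ = 2 ^ k * (fixCount C c * (addOrderOf c).totient) := by ring
    _ = 2 ^ k * (n.totient * rootCount C (addOrderOf c)) := by rw [fixCount_mul_totient]
    _ ≤ 2 ^ k * (n * (2 * C) ^ k) := by gcongr; exact Nat.totient_le n
    _ = (4 * C) ^ k * n := by rw [show 4 * C = 2 * (2 * C) by ring, mul_pow 2 (2 * C)]; ring

/-- The solutions form a coset, by w, of the group of units whose C-th power fixes c. -/
lemma card_pow_mul_eq (C : ℕ) (c : ZMod n) (w : (ZMod n)ˣ) :
    (Finset.univ.filter fun u : (ZMod n)ˣ => (u : ZMod n) ^ C * c = (w : ZMod n) ^ C * c).card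
      = fixCount C c := by
  refine Finset.card_equiv (Equiv.mulRight w⁻¹) fun u => ?_
  simp only [Finset.mem_filter, Finset.mem_univ, true_and, Equiv.coe_mulRight, Units.val_mul,
    mul_pow]
  have h : ((w⁻¹ : (ZMod n)ˣ) : ZMod n) ^ C * (w : ZMod n) ^ C = 1 := by
    rw [← mul_pow, Units.inv_mul, one_pow]
  constructor
  · intro hu
    rw [mul_right_comm, hu]
    linear_combination c * h
  · intro hu
    linear_combination (w : ZMod n) ^ C * hu - (u : ZMod n) ^ C * c * h

/-- The exponential sum over `C`-th powers of units at frequency `c`. -/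
noncomputable def unitPowSum (C : ℕ) (c : ZMod n) : ℂ :=
  ∑ u : (ZMod n)ˣ, ZMod.stdAddChar ((u : ZMod n) ^ C * c)

lemma unitPowSum_pow_mul (C : ℕ) (c : ZMod n) (v : (ZMod n)ˣ) :
    unitPowSum C ((v : ZMod n) ^ C * c) = unitPowSum C c := by
  refine Fintype.sum_equiv (Equiv.mulRight v) _ _ fun u => ?_
  simp only [Equiv.coe_mulRight, Units.val_mul, mul_pow, mul_assoc]

/-- Expand the square; orthogonality in y leaves n times the number of pairs with u^C c = w^C c, and
each w has `fixCount C c` partners. -/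
lemma sum_norm_sq_unitPowSum (C : ℕ) (c : ZMod n) :
    ∑ y : ZMod n, ‖unitPowSum C (y * c)‖ ^ 2 = n * (n.totient * fixCount C c) := by
  have h : ∀ y : ZMod n, ((‖unitPowSum C (y * c)‖ ^ 2 : ℝ) : ℂ)
      = ∑ u : (ZMod n)ˣ, ∑ w : (ZMod n)ˣ,
        ZMod.stdAddChar (y * ((u : ZMod n) ^ C * c - (w : ZMod n) ^ C * c)) := by
    intro y
    rw [Complex.ofReal_pow, ← Complex.mul_conj', unitPowSum, map_sum, Finset.sum_mul_sum]
    refine Finset.sum_congr rfl fun u _ => Finset.sum_congr rfl fun w _ => ?_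
    rw [← AddChar.map_neg_eq_conj, ← AddChar.map_add_eq_mul]
    congr 1
    ring
  have h2 : ((∑ y : ZMod n, ‖unitPowSum C (y * c)‖ ^ 2 : ℝ) : ℂ)
      = ((n * (n.totient * fixCount C c) : ℝ) : ℂ) := by
    rw [Complex.ofReal_sum, Finset.sum_congr rfl fun y _ => h y, Finset.sum_comm]
    rw [Finset.sum_congr rfl fun u _ => Finset.sum_comm]
    simp_rw [AddChar.sum_mulShift _ (ZMod.isPrimitive_stdAddChar n), sub_eq_zero]
    rw [Finset.sum_comm]
    have : ∀ w : (ZMod n)ˣ, ∑ u : (ZMod n)ˣ,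
        (((if (u : ZMod n) ^ C * c = (w : ZMod n) ^ C * c then Fintype.card (ZMod n) else 0 : ℕ)) : ℂ)
        = n * fixCount C c := by
      intro w
      rw [← card_pow_mul_eq C c w, ZMod.card]
      push_cast
      rw [← Finset.sum_filter, Finset.sum_const, nsmul_eq_mul, mul_comm]
    rw [Finset.sum_congr rfl fun w _ => this w, Finset.sum_const, Finset.card_univ,
      ZMod.card_units_eq_totient]
    push_cast
    rw [nsmul_eq_mul]
    ring
  exact_mod_cast h2

lemma sum_comp_le_mul_sum {α β : Type*} [Fintype α] [Fintype β] [DecidableEq β] (f : α → β)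
    (g : β → ℝ) (hg : ∀ b, 0 ≤ g b) (l : ℕ)
    (hl : ∀ a, (Finset.univ.filter fun a' => f a' = f a).card ≤ l) :
    ∑ a, g (f a) ≤ l * ∑ b, g b := by
  rw [← Finset.sum_fiberwise (s := Finset.univ) (g := f), Finset.mul_sum]
  refine Finset.sum_le_sum fun b _ => ?_
  rw [Finset.sum_congr rfl (g := fun _ => g b) fun a ha => by rw [(Finset.mem_filter.1 ha).2],
    Finset.sum_const, nsmul_eq_mul]
  refine mul_le_mul_of_nonneg_right ?_ (hg b)
  norm_cast
  by_cases h : ∃ a, f a = b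
  · obtain ⟨a, rfl⟩ := h
    exact hl a
  · rw [Finset.filter_false_of_mem fun a _ hab => h ⟨a, hab⟩]
    simp

/-- The sum at yc equals the sum at c whenever y = v^C + z with v a unit and zc = 0. There are
φ(n)·|Z| such pairs (v, z), each y arising from at most `fixCount C c` of them, so φ(n)·|Z| copies
of the squared norm fit into `fixCount C c` times the second moment. Finally |Z| is at least n
divided by the order of c. -/
lemma norm_sq_unitPowSum_le (C : ℕ) (c : ZMod n) :
    ‖unitPowSum C c‖ ^ 2 ≤ (fixCount C c : ℝ) ^ 2 * addOrderOf c := by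
  set Z := Finset.univ.filter fun z : ZMod n => z * c = 0
  have h1 := sum_comp_le_mul_sum
    (fun p : (ZMod n)ˣ × Z => (p.1 : ZMod n) ^ C + (p.2 : ZMod n))
    (fun y => ‖unitPowSum C (y * c)‖ ^ 2) (fun _ => by positivity) (fixCount C c) ?_
  · have h2 : ∀ p : (ZMod n)ˣ × Z,
        ‖unitPowSum C (((p.1 : ZMod n) ^ C + (p.2 : ZMod n)) * c)‖ ^ 2 = ‖unitPowSum C c‖ ^ 2 := by
      intro p
      rw [add_mul, (Finset.mem_filter.1 p.2.2).2, add_zero, unitPowSum_pow_mul]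
    rw [Finset.sum_congr rfl fun p _ => h2 p, Finset.sum_const, Finset.card_univ,
      Fintype.card_prod, ZMod.card_units_eq_totient, Fintype.card_coe, nsmul_eq_mul,
      sum_norm_sq_unitPowSum] at h1
    push_cast at h1
    have h3 : (n : ℝ) ≤ Z.card * addOrderOf c := by
      exact_mod_cast le_card_annihilator_mul_addOrderOf c
    have hn : (0 : ℝ) < n := by exact_mod_cast NeZero.pos n
    have hφ : (0 : ℝ) < n.totient := by exact_mod_cast Nat.totient_pos.2 (NeZero.pos n)
    have h4 : Z.card * ‖unitPowSum C c‖ ^ 2 ≤ n * (fixCount C c : ℝ) ^ 2 := by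
      refine le_of_mul_le_mul_left ?_ hφ
      linarith
    refine le_of_mul_le_mul_left ?_ hn
    calc n * ‖unitPowSum C c‖ ^ 2 ≤ Z.card * addOrderOf c * ‖unitPowSum C c‖ ^ 2 := by gcongr
      _ = addOrderOf c * (Z.card * ‖unitPowSum C c‖ ^ 2) := by ring
      _ ≤ addOrderOf c * (n * (fixCount C c : ℝ) ^ 2) := by gcongr
      _ = _ := by ring
  -- Multiplying v'^C + z' = v^C + z by c removes z and z', leaving v'^C c = v^C c; and v'
  -- determines z'.
  · rintro ⟨v, z, hz⟩
    rw [← card_pow_mul_eq C c v]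
    refine Finset.card_le_card_of_injOn Prod.fst ?_ ?_
    · rintro ⟨v', z', hz'⟩ h
      have h := (Finset.mem_filter.1 h).2
      have hz := (Finset.mem_filter.1 hz).2
      have hz' := (Finset.mem_filter.1 hz').2
      simp only [Finset.coe_filter, Finset.mem_univ, true_and, Set.mem_ofPred_eq]
      linear_combination c * h - hz' + hz
    · rintro ⟨v1, z1, hz1⟩ h1 ⟨v2, z2, hz2⟩ h2 h12
      have h1 := (Finset.mem_filter.1 h1).2
      have h2 := (Finset.mem_filter.1 h2).2
      simp only at h1 h2 h12
      subst h12
      have : z1 = z2 := add_left_cancel (h1.trans h2.symm)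
      subst this
      rfl

open ArithmeticFunction in
/-- Square-root cancellation in exponential sums over `C`-th powers of units. -/
theorem norm_sq_unitPowSum_mul_addOrderOf_le {C k : ℕ} (hC : 0 < C)
    (hk : cardDistinctFactors n ≤ k) (c : ZMod n) :
    ‖unitPowSum C c‖ ^ 2 * addOrderOf c ≤ ((8 * C : ℝ) ^ k * n.totient) ^ 2 := by
  have h1 := norm_sq_unitPowSum_le C c
  have h2 : (fixCount C c : ℝ) * addOrderOf c ≤ (4 * C) ^ k * n := by
    exact_mod_cast fixCount_mul_addOrderOf_le hC hk c
  have h3 : (n : ℝ) ≤ 2 ^ k * n.totient := by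
    have : n ≤ 2 ^ k * n.totient := le_two_pow_mul_totient.trans (by gcongr; norm_num)
    exact_mod_cast this
  calc ‖unitPowSum C c‖ ^ 2 * addOrderOf c
      ≤ (fixCount C c : ℝ) ^ 2 * addOrderOf c * addOrderOf c := by gcongr
    _ = (fixCount C c * addOrderOf c : ℝ) ^ 2 := by ring
    _ ≤ ((4 * C : ℝ) ^ k * n) ^ 2 := by gcongr
    _ ≤ ((4 * C : ℝ) ^ k * (2 ^ k * n.totient)) ^ 2 := by gcongr
    _ = _ := by
      rw [show (8 * C : ℝ) = 4 * C * 2 by ring, mul_pow (4 * C : ℝ) 2 k]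
      ring

end PowerOrbit

/-! ### Counting C-th roots, and truncation to residues with small gcd. -/

namespace PowerOrbit

lemma sum_range_eq_sum_zmod {E : Type*} [AddCommMonoid E] (n : ℕ) [NeZero n] (g : ℕ → E) :
    ∑ i ∈ Finset.range n, g i = ∑ x : ZMod n, g x.val := by
  refine Finset.sum_bij' (fun i _ => (i : ZMod n)) (fun x _ => x.val) (by simp)
    (fun x _ => by simpa using x.val_lt) (fun i hi => ?_) (by simp) (fun i hi => ?_) <;>
  simp [ZMod.val_cast_of_lt (Finset.mem_range.1 hi)]

lemma powCount_eq_card (C n x : ℕ) [NeZero n] :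
    powCount C n x = (Finset.univ.filter fun t : ZMod n => t ^ C = x).card := by
  have hn := NeZero.pos n
  refine Finset.card_bij (fun t _ => (t : ZMod n)) ?_ ?_ ?_
  · intro t ht
    have := (Finset.mem_filter.1 ht).2
    simp only [Finset.mem_filter, Finset.mem_univ, true_and]
    rw [← Nat.cast_pow, ZMod.natCast_eq_natCast_iff]
    exact this
  · intro s hs t ht hst
    have hs := Finset.mem_Icc.1 (Finset.mem_filter.1 hs).1
    have ht := Finset.mem_Icc.1 (Finset.mem_filter.1 ht).1
    rw [ZMod.natCast_eq_natCast_iff] at hst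
    have h2 : s - 1 ≡ t - 1 [MOD n] := by
      refine Nat.ModEq.add_right_cancel' 1 ?_
      rwa [Nat.sub_add_cancel hs.1, Nat.sub_add_cancel ht.1]
    have := Nat.ModEq.eq_of_lt_of_lt h2 (by lia) (by lia)
    lia
  · intro t ht
    have ht := (Finset.mem_filter.1 ht).2
    have key : ∀ s : ℕ, (s : ZMod n) = t → s ^ C ≡ x [MOD n] := by
      intro s hs
      rw [← ZMod.natCast_eq_natCast_iff, Nat.cast_pow, hs, ht]
    by_cases h0 : t = 0
    -- The zero class is represented by n, since the count runs over [1, n] rather than [0, n).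
    · refine ⟨n, Finset.mem_filter.2 ⟨Finset.mem_Icc.2 ⟨hn, le_rfl⟩, key n ?_⟩, ?_⟩ <;> simp [h0]
    · refine ⟨t.val, Finset.mem_filter.2 ⟨Finset.mem_Icc.2 ⟨?_, t.val_lt.le⟩, key _ ?_⟩, ?_⟩
      · exact Nat.pos_of_ne_zero fun h => h0 ((ZMod.val_eq_zero t).1 h)
      · simp
      · simp

variable {n : ℕ} [NeZero n]

lemma sum_card_mul_eq_sum_comp (C : ℕ) (p : ZMod n → Prop) [DecidablePred p] (F : ZMod n → ℂ) :
    ∑ x, ((Finset.univ.filter fun t : ZMod n => t ^ C = x ∧ p t).card : ℂ) * F x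
      = ∑ t ∈ Finset.univ.filter p, F (t ^ C) := by
  rw [← Finset.sum_fiberwise (s := Finset.univ.filter p) (g := fun t => t ^ C)]
  refine Finset.sum_congr rfl fun x _ => ?_
  rw [Finset.sum_congr rfl (g := fun _ => F x) fun t ht => by rw [(Finset.mem_filter.1 ht).2],
    Finset.sum_const, nsmul_eq_mul, Finset.filter_filter]
  simp only [and_comm]

/-- The number of `C`-th roots `t` of `i` modulo `n` with `gcd(t, n) ≤ B`, the latter condition
being expressed through the additive order of `t`. -/
noncomputable def tameCount (C B : ℕ) (i : ZMod n) : ℕ :=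
  (Finset.univ.filter fun t : ZMod n => t ^ C = i ∧ n ≤ B * addOrderOf t).card

lemma addOrderOf_units_mul {m : ℕ} (u : (ZMod m)ˣ) (t : ZMod m) :
    addOrderOf ((u : ZMod m) * t) = addOrderOf t :=
  addOrderOf_injective (AddMonoidHom.mulLeft (u : ZMod m)) (fun _ _ h => u.mul_right_inj.1 h) t

lemma tameCount_pow_mul (C B : ℕ) (u : (ZMod n)ˣ) (i : ZMod n) :
    tameCount C B ((u : ZMod n) ^ C * i) = tameCount C B i := by
  symm
  refine Finset.card_equiv (Units.mulLeft u) fun t => ?_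
  simp only [Finset.mem_filter, Finset.mem_univ, true_and, Units.mulLeft_apply, mul_pow,
    addOrderOf_units_mul]
  rw [← Units.val_pow_eq_pow_val, Units.mul_right_inj]

open ArithmeticFunction in
-- A nonempty solution set has `fixCount` elements, and d^C has order n / gcd(n, d^C) ≥ n / B^C, so
-- the bound on `fixCount` times the order no longer depends on n.
lemma card_units_pow_mul_le {C k B d : ℕ} (hC : 0 < C) (hk : cardDistinctFactors n ≤ k)
    (hd : 0 < d) (hdB : d ≤ B) (i : ZMod n) :
    (Finset.univ.filter fun u : (ZMod n)ˣ => (u : ZMod n) ^ C * (d : ZMod n) ^ C = i).card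
      ≤ (4 * C) ^ k * B ^ C := by
  rcases Finset.eq_empty_or_nonempty
    (Finset.univ.filter fun u : (ZMod n)ˣ => (u : ZMod n) ^ C * (d : ZMod n) ^ C = i) with h | h
  · simp [h]
  obtain ⟨w, hw⟩ := h
  rw [← (Finset.mem_filter.1 hw).2, card_pow_mul_eq]
  have h1 := fixCount_mul_addOrderOf_le hC hk ((d : ZMod n) ^ C)
  have h2 : n ≤ B ^ C * addOrderOf ((d : ZMod n) ^ C) := by
    rw [← Nat.cast_pow, ZMod.addOrderOf_coe _ (NeZero.ne n)]
    calc n = n.gcd (d ^ C) * (n / n.gcd (d ^ C)) := (Nat.mul_div_cancel' (Nat.gcd_dvd_left _ _)).symm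
      _ ≤ B ^ C * (n / n.gcd (d ^ C)) := by
        gcongr
        exact (Nat.gcd_le_right _ (pow_pos hd C)).trans (Nat.pow_le_pow_left hdB C)
  refine Nat.le_of_mul_le_mul_right (h1.trans ?_) (addOrderOf_pos ((d : ZMod n) ^ C))
  rw [mul_assoc]
  gcongr

open ArithmeticFunction in
-- Every residue is a unit times the divisor d = gcd(t, n). Tameness says d ≤ B, which leaves at
-- most B choices of d.
theorem tameCount_le {C k : ℕ} (B : ℕ) (hC : 0 < C) (hk : cardDistinctFactors n ≤ k)
    (i : ZMod n) : tameCount C B i ≤ B * ((4 * C) ^ k * B ^ C) := by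
  have hsub : (Finset.univ.filter fun t : ZMod n => t ^ C = i ∧ n ≤ B * addOrderOf t)
      ⊆ (Finset.Icc 1 B).biUnion fun d =>
        (Finset.univ.filter fun u : (ZMod n)ˣ => (u : ZMod n) ^ C * (d : ZMod n) ^ C = i).image
          fun u : (ZMod n)ˣ => (u : ZMod n) * (d : ZMod n) := by
    intro t ht
    obtain ⟨ht1, ht2⟩ := (Finset.mem_filter.1 ht).2
    obtain ⟨d, hdn, _, ⟨u, rfl⟩, rfl⟩ := ZMod.eq_unit_mul_divisor t
    rw [addOrderOf_units_mul, ZMod.addOrderOf_coe _ (NeZero.ne n), Nat.gcd_eq_right hdn] at ht2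
    have hd : 0 < d := Nat.pos_of_dvd_of_pos hdn (NeZero.pos n)
    have hq : 0 < n / d := Nat.div_pos (Nat.le_of_dvd (NeZero.pos n) hdn) hd
    have hdB : d ≤ B := by
      refine Nat.le_of_mul_le_mul_right ?_ hq
      rwa [Nat.mul_div_cancel' hdn]
    refine Finset.mem_biUnion.2 ⟨d, Finset.mem_Icc.2 ⟨hd, hdB⟩, Finset.mem_image.2 ⟨u, ?_, rfl⟩⟩
    rw [← ht1, mul_pow]
    simp
  refine (Finset.card_le_card hsub).trans ((Finset.card_biUnion_le_card_mul _ _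
    ((4 * C) ^ k * B ^ C) fun d hd => ?_).trans (by simp))
  have hd := Finset.mem_Icc.1 hd
  exact Finset.card_image_le.trans (card_units_pow_mul_le hC hk hd.1 hd.2 i)

lemma card_dvd_val_mul_le {D : ℕ} (hD : 0 < D) (hDn : D ∣ n) :
    (Finset.univ.filter fun t : ZMod n => D ∣ t.val).card * D ≤ n := by
  rw [← Nat.le_div_iff_mul_le hD, ← Finset.card_range (n / D)]
  refine Finset.card_le_card_of_injOn (fun t => t.val / D) ?_ ?_
  · intro t _
    rw [Finset.coe_range, Set.mem_Iio]
    exact Nat.div_lt_div_of_lt_of_dvd hDn t.val_lt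
  · intro s hs t ht hst
    have hs : D ∣ s.val := by simpa using hs
    have ht : D ∣ t.val := by simpa using ht
    refine ZMod.val_injective n ?_
    rw [← Nat.div_mul_cancel hs, ← Nat.div_mul_cancel ht]
    exact congrArg (· * D) hst

open ArithmeticFunction in
/-- Few residues have a large common divisor with a modulus having few prime factors. -/
theorem card_not_tame_mul_le {k L : ℕ} (hL : 0 < L) (hk : cardDistinctFactors n ≤ k) :
    (Finset.univ.filter fun t : ZMod n => ¬ n ≤ L ^ k * addOrderOf t).card * L ≤ k * n := by
  have hn := NeZero.pos n
  -- D p is the least power of p exceeding L. If gcd(t, n) > L^k, then one of its at most k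
  -- prime-power components exceeds L, so D p divides t.
  set D : ℕ → ℕ := fun p => p ^ (Nat.log p L + 1)
  have hsub : (Finset.univ.filter fun t : ZMod n => ¬ n ≤ L ^ k * addOrderOf t)
      ⊆ (n.primeFactors.filter fun p => D p ∣ n).biUnion fun p =>
        Finset.univ.filter fun t : ZMod n => D p ∣ t.val := by
    intro t ht
    have ht := (Finset.mem_filter.1 ht).2
    rw [not_le, ← ZMod.natCast_zmod_val t, ZMod.addOrderOf_coe _ hn.ne'] at ht
    set g := n.gcd t.val
    have hgn : g ∣ n := Nat.gcd_dvd_left _ _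
    have hg0 : 0 < g := Nat.gcd_pos_of_pos_left _ hn
    have hg : L ^ k < g := by
      refine Nat.lt_of_mul_lt_mul_right (a := n / g) ?_
      rwa [Nat.mul_div_cancel' hgn]
    obtain ⟨p, hp, hLp⟩ : ∃ p ∈ g.primeFactors, L < p ^ g.factorization p := by
      by_contra! hcon
      have h1 : g ≤ L ^ g.primeFactors.card := by
        conv_lhs => rw [← Nat.prod_factorization_pow_eq_self hg0.ne']
        exact Finset.prod_le_pow_card _ _ _ hcon
      have h2 : g.primeFactors.card ≤ k := by
        rw [← cardDistinctFactors_eq_card_primeFactors]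
        exact (cardDistinctFactors_le_of_dvd hgn hn.ne').trans hk
      exact absurd (h1.trans (Nat.pow_le_pow_right hL h2)) (not_le.2 hg)
    have hpp := Nat.prime_of_mem_primeFactors hp
    have hDg : D p ∣ g := by
      refine (Nat.pow_dvd_pow p ?_).trans (Nat.ordProj_dvd g p)
      exact Nat.log_lt_of_lt_pow hL.ne' hLp
    refine Finset.mem_biUnion.2 ⟨p, Finset.mem_filter.2
      ⟨Nat.primeFactors_mono hgn hn.ne' hp, hDg.trans hgn⟩, Finset.mem_filter.2
        ⟨Finset.mem_univ _, hDg.trans (Nat.gcd_dvd_right _ _)⟩⟩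
  have hcard : (Finset.univ.filter fun t : ZMod n => ¬ n ≤ L ^ k * addOrderOf t).card
      ≤ k * (n / L) := by
    refine (Finset.card_le_card hsub).trans ((Finset.card_biUnion_le_card_mul _ _ (n / L)
      fun p hp => ?_).trans ?_)
    · obtain ⟨hp, hDn⟩ := Finset.mem_filter.1 hp
      have hpp := Nat.prime_of_mem_primeFactors hp
      have hDL : L < D p := Nat.lt_pow_succ_log_self hpp.one_lt L
      rw [Nat.le_div_iff_mul_le hL]
      exact (Nat.mul_le_mul_left _ hDL.le).trans (card_dvd_val_mul_le (hL.trans hDL) hDn)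
    · gcongr
      refine (Finset.card_filter_le _ _).trans ?_
      rwa [← cardDistinctFactors_eq_card_primeFactors]
  calc _ ≤ k * (n / L) * L := by gcongr
    _ = k * (n / L * L) := by ring
    _ ≤ k * n := by gcongr; exact Nat.div_mul_le_self n L

end PowerOrbit

/-! ### Fourier splitting, and removal of high frequencies by short shifts. -/

namespace PowerOrbit

lemma norm_sum_mul_le_of_sq_le {ι : Type*} (s : Finset ι) (a b : ι → ℂ) {α β γ : ℝ}
    (ha : ∑ i ∈ s, ‖a i‖ ^ 2 ≤ α) (hb : ∑ i ∈ s, ‖b i‖ ^ 2 ≤ β) (hγ : 0 ≤ γ)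
    (h : α * β ≤ γ ^ 2) : ‖∑ i ∈ s, a i * b i‖ ≤ γ := by
  refine abs_le_of_sq_le_sq' ?_ hγ |>.2
  calc ‖∑ i ∈ s, a i * b i‖ ^ 2 ≤ (∑ i ∈ s, ‖a i‖ * ‖b i‖) ^ 2 := by
        gcongr
        exact norm_sum_le_of_le _ fun i _ => (norm_mul _ _).le
    _ ≤ (∑ i ∈ s, ‖a i‖ ^ 2) * ∑ i ∈ s, ‖b i‖ ^ 2 := Finset.sum_mul_sq_le_sq_mul_sq _ _ _
    _ ≤ α * β := mul_le_mul ha hb (Finset.sum_nonneg fun _ _ => by positivity)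
        ((Finset.sum_nonneg fun _ _ => by positivity).trans ha)
    _ ≤ γ ^ 2 := h

variable {n : ℕ} [NeZero n]

/-- The trigonometric polynomial on `ZMod n` with coefficients `a`. -/
noncomputable def trigPoly (a : ZMod n → ℂ) (i : ZMod n) : ℂ :=
  ∑ c, a c * ZMod.stdAddChar (c * i)

/-- The normalized Fourier coefficients of a function on `ZMod n`. -/
noncomputable def fourierCoef (Φ : ZMod n → ℂ) (c : ZMod n) : ℂ := (n : ℂ)⁻¹ * ZMod.dft Φ c

lemma trigPoly_fourierCoef (Φ : ZMod n → ℂ) (i : ZMod n) : trigPoly (fourierCoef Φ) i = Φ i := by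
  conv_rhs => rw [← ZMod.dft.symm_apply_apply Φ, ZMod.invDFT_apply, smul_eq_mul, Finset.mul_sum]
  refine Finset.sum_congr rfl fun c _ => ?_
  rw [fourierCoef, smul_eq_mul]
  ring

lemma sum_norm_sq_trigPoly (a : ZMod n → ℂ) :
    ∑ i, ‖trigPoly a i‖ ^ 2 = n * ∑ c, ‖a c‖ ^ 2 := by
  have h : ∀ i : ZMod n, ((‖trigPoly a i‖ ^ 2 : ℝ) : ℂ)
      = ∑ c, ∑ d, a c * (starRingEnd ℂ) (a d) * ZMod.stdAddChar (i * (c - d)) := by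
    intro i
    rw [Complex.ofReal_pow, ← Complex.mul_conj', trigPoly, map_sum, Finset.sum_mul_sum]
    refine Finset.sum_congr rfl fun c _ => Finset.sum_congr rfl fun d _ => ?_
    rw [map_mul (starRingEnd ℂ), ← AddChar.map_neg_eq_conj, mul_mul_mul_comm, ← AddChar.map_add_eq_mul]
    congr 2
    ring
  have h2 : ((∑ i, ‖trigPoly a i‖ ^ 2 : ℝ) : ℂ) = ((n * ∑ c, ‖a c‖ ^ 2 : ℝ) : ℂ) := by
    rw [Complex.ofReal_sum, Finset.sum_congr rfl fun i _ => h i, Finset.sum_comm]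
    rw [Finset.sum_congr rfl fun c _ => Finset.sum_comm]
    simp_rw [← Finset.mul_sum, AddChar.sum_mulShift _ (ZMod.isPrimitive_stdAddChar n), sub_eq_zero]
    push_cast
    rw [Finset.mul_sum]
    refine Finset.sum_congr rfl fun c _ => ?_
    simp only [mul_ite, mul_zero, Finset.sum_ite_eq, Finset.mem_univ, if_true, ZMod.card]
    rw [Complex.mul_conj', mul_comm]
  exact_mod_cast h2

lemma sum_norm_sq_fourierCoef_le {Φ : ZMod n → ℂ} {K : ℝ} (hΦ : ∀ i, ‖Φ i‖ ≤ K) :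
    ∑ c, ‖fourierCoef Φ c‖ ^ 2 ≤ K ^ 2 := by
  have h := sum_norm_sq_trigPoly (fourierCoef Φ)
  simp_rw [trigPoly_fourierCoef] at h
  have hn : (0 : ℝ) < n := by exact_mod_cast NeZero.pos n
  refine le_of_mul_le_mul_left ?_ hn
  rw [← h]
  calc _ ≤ ∑ _i : ZMod n, K ^ 2 := by gcongr with i; exact hΦ i
    _ = n * K ^ 2 := by simp [ZMod.card]

/-- Dilating a function by a unit dilates its transform by the inverse unit, so invariance under
C-th powers of units passes to the coefficients. -/
lemma fourierCoef_pow_mul {Φ : ZMod n → ℂ} {C : ℕ}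
    (hinv : ∀ (u : (ZMod n)ˣ) i, Φ ((u : ZMod n) ^ C * i) = Φ i) (u : (ZMod n)ˣ) (c : ZMod n) :
    fourierCoef Φ ((u : ZMod n) ^ C * c) = fourierCoef Φ c := by
  have h := ZMod.dft_comp_unitMul Φ (u⁻¹ ^ C) c
  have hΦ : (fun j => Φ (((u⁻¹ ^ C : (ZMod n)ˣ) : ZMod n) * j)) = Φ := by
    funext j
    rw [Units.val_pow_eq_pow_val, hinv]
  rw [hΦ, inv_pow, inv_inv, Units.val_pow_eq_pow_val] at h
  rw [fourierCoef, fourierCoef, h]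

/-- The part of a function on `ZMod n` with frequencies of additive order at most `R`. -/
noncomputable def lowPart (R : ℕ) (Φ : ZMod n → ℂ) : ZMod n → ℂ :=
  trigPoly fun c => if addOrderOf c ≤ R then fourierCoef Φ c else 0

/-- The part of a function on `ZMod n` with frequencies of additive order larger than `R`. -/
noncomputable def highPart (R : ℕ) (Φ : ZMod n → ℂ) : ZMod n → ℂ :=
  trigPoly fun c => if R < addOrderOf c then fourierCoef Φ c else 0

lemma lowPart_add_highPart (R : ℕ) (Φ : ZMod n → ℂ) (i : ZMod n) :
    lowPart R Φ i + highPart R Φ i = Φ i := by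
  rw [← trigPoly_fourierCoef Φ i, lowPart, highPart, trigPoly, trigPoly, ← Finset.sum_add_distrib]
  refine Finset.sum_congr rfl fun c _ => ?_
  by_cases h : addOrderOf c ≤ R
  · simp [h, not_lt.2 h]
  · simp [h, not_le.1 h]

lemma lowPart_add_factorial (R : ℕ) (Φ : ZMod n → ℂ) (i : ZMod n) :
    lowPart R Φ (i + (R.factorial : ℕ)) = lowPart R Φ i := by
  refine Finset.sum_congr rfl fun c _ => ?_
  by_cases h : addOrderOf c ≤ R
  · have : c * (R.factorial : ℕ) = 0 := by
      rw [mul_comm, ← nsmul_eq_mul, ← addOrderOf_dvd_iff_nsmul_eq_zero]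
      exact Nat.dvd_factorial (addOrderOf_pos c) h
    rw [mul_add, this, add_zero]
  · simp [h]

/-- Every frequency of order at most R is killed by R!, so there are at most R! of them; by Parseval
each coefficient is at most K. -/
lemma norm_lowPart_le (R : ℕ) {Φ : ZMod n → ℂ} {K : ℝ} (hK : 0 ≤ K) (hΦ : ∀ i, ‖Φ i‖ ≤ K)
    (i : ZMod n) : ‖lowPart R Φ i‖ ≤ R.factorial * K := by
  have hc : ∀ c, ‖fourierCoef Φ c‖ ≤ K := fun c => by
    refine abs_le_of_sq_le_sq' ?_ hK |>.2
    exact (Finset.single_le_sum (f := fun c => ‖fourierCoef Φ c‖ ^ 2) (fun _ _ => by positivity)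
      (Finset.mem_univ c)).trans (sum_norm_sq_fourierCoef_le hΦ)
  have hcard : (Finset.univ.filter fun c : ZMod n => R.factorial • c = 0).card ≤ R.factorial :=
    IsAddCyclic.card_nsmul_eq_zero_le (Nat.factorial_pos R)
  calc ‖lowPart R Φ i‖
      ≤ ∑ c : ZMod n, if R.factorial • c = 0 then K else 0 := by
        refine norm_sum_le_of_le _ fun c _ => ?_
        rw [norm_mul, AddChar.norm_apply, mul_one]
        by_cases h : addOrderOf c ≤ R
        · have : R.factorial • c = 0 :=
            addOrderOf_dvd_iff_nsmul_eq_zero.1 (Nat.dvd_factorial (addOrderOf_pos c) h)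
          simpa [h, this] using hc c
        · simp only [if_neg h, norm_zero]
          split_ifs
          exacts [hK, le_rfl]
    _ = (Finset.univ.filter fun c : ZMod n => R.factorial • c = 0).card * K := by
        rw [← Finset.sum_filter, Finset.sum_const, nsmul_eq_mul]
    _ ≤ R.factorial * K := by gcongr

lemma sum_norm_sq_highPart_le (R : ℕ) {Φ : ZMod n → ℂ} {K : ℝ} (hΦ : ∀ i, ‖Φ i‖ ≤ K) :
    ∑ i, ‖highPart R Φ i‖ ^ 2 ≤ n * K ^ 2 := by
  rw [highPart, sum_norm_sq_trigPoly]
  gcongr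
  refine le_trans (Finset.sum_le_sum fun c _ => ?_) (sum_norm_sq_fourierCoef_le hΦ)
  split_ifs
  · exact le_rfl
  · simp

/-- The Dirichlet-type kernel of the averages over shifts by multiples of `q`. -/
noncomputable def shiftKernel (q : ℕ) (c : ZMod n) : ℂ :=
  ∑ s ∈ Finset.range q, ZMod.stdAddChar (c * ((s * q : ℕ) : ZMod n))

lemma sum_trigPoly_add (q : ℕ) (a : ZMod n → ℂ) (i : ZMod n) :
    ∑ s ∈ Finset.range q, trigPoly a (i + ((s * q : ℕ) : ZMod n))
      = trigPoly (fun c => a c * shiftKernel q c) i := by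
  simp only [trigPoly, shiftKernel]
  rw [Finset.sum_comm]
  refine Finset.sum_congr rfl fun c _ => ?_
  rw [Finset.mul_sum, Finset.sum_mul]
  refine Finset.sum_congr rfl fun s _ => ?_
  rw [mul_add, AddChar.map_add_eq_mul]
  ring

/-- Expanding the square, the q diagonal pairs give φ(n) each, and the at most q² others give at
most φ(n)/q each by `hS`. -/
lemma sum_units_norm_sq_shiftKernel_le {C q R : ℕ} (hq : 0 < q)
    (hS : ∀ c : ZMod n, R < addOrderOf c → ∀ s < q, ∀ t < q, s ≠ t →
      ‖unitPowSum C (c * ((s * q : ℕ) : ZMod n) - c * ((t * q : ℕ) : ZMod n))‖ * q ≤ n.totient)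
    (c : ZMod n) (hc : R < addOrderOf c) :
    ∑ u : (ZMod n)ˣ, ‖shiftKernel q ((u : ZMod n) ^ C * c)‖ ^ 2 ≤ 2 * q * n.totient := by
  have h : ((∑ u : (ZMod n)ˣ, ‖shiftKernel q ((u : ZMod n) ^ C * c)‖ ^ 2 : ℝ) : ℂ)
      = ∑ s ∈ Finset.range q, ∑ t ∈ Finset.range q,
        unitPowSum C (c * ((s * q : ℕ) : ZMod n) - c * ((t * q : ℕ) : ZMod n)) := by
    rw [Complex.ofReal_sum]
    simp only [unitPowSum]
    rw [Finset.sum_congr rfl fun s _ => Finset.sum_comm, Finset.sum_comm]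
    refine Finset.sum_congr rfl fun u _ => ?_
    rw [Complex.ofReal_pow, ← Complex.mul_conj', shiftKernel, map_sum, Finset.sum_mul_sum]
    refine Finset.sum_congr rfl fun s _ => Finset.sum_congr rfl fun t _ => ?_
    rw [← AddChar.map_neg_eq_conj, ← AddChar.map_add_eq_mul]
    congr 1
    ring
  have hq' : (0 : ℝ) < q := by exact_mod_cast hq
  have h2 : ‖((∑ u : (ZMod n)ˣ, ‖shiftKernel q ((u : ZMod n) ^ C * c)‖ ^ 2 : ℝ) : ℂ)‖
      ≤ 2 * q * n.totient := by
    rw [h]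
    calc _ ≤ ∑ s ∈ Finset.range q, ∑ t ∈ Finset.range q,
          ((if s = t then (n.totient : ℝ) else 0) + n.totient / q) := by
          refine norm_sum_le_of_le _ fun s hs => norm_sum_le_of_le _ fun t ht => ?_
          split_ifs with hst
          · subst hst
            rw [sub_self, unitPowSum]
            simp only [mul_zero, AddChar.map_zero_eq_one, Finset.sum_const, Finset.card_univ,
              ZMod.card_units_eq_totient, nsmul_eq_mul, mul_one, Complex.norm_natCast]
            have : (0 : ℝ) ≤ n.totient / q := by positivity
            linarith
          · rw [zero_add, le_div_iff₀ hq']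
            exact hS c hc s (Finset.mem_range.1 hs) t (Finset.mem_range.1 ht) hst
      _ = _ := by
          simp_rw [Finset.sum_add_distrib, Finset.sum_ite_eq, Finset.sum_const, Finset.card_range,
            nsmul_eq_mul]
          rw [Finset.sum_congr rfl (g := fun _ => (n.totient : ℝ))
            fun s hs => if_pos hs, Finset.sum_const, Finset.card_range, nsmul_eq_mul]
          field_simp
          ring
  rw [Complex.norm_real] at h2
  exact (Real.le_norm_self _).trans h2

/-- Averaging over short arithmetic progressions kills the high frequencies of a function that is
invariant under multiplication by `C`-th powers of units. -/
theorem sum_norm_sq_sum_highPart_le {C q R : ℕ} (hq : 0 < q) {Φ : ZMod n → ℂ} {K : ℝ}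
    (hΦ : ∀ i, ‖Φ i‖ ≤ K) (hinv : ∀ (u : (ZMod n)ˣ) i, Φ ((u : ZMod n) ^ C * i) = Φ i)
    (hS : ∀ c : ZMod n, R < addOrderOf c → ∀ s < q, ∀ t < q, s ≠ t →
      ‖unitPowSum C (c * ((s * q : ℕ) : ZMod n) - c * ((t * q : ℕ) : ZMod n))‖ * q ≤ n.totient) :
    ∑ i, ‖∑ s ∈ Finset.range q, highPart R Φ (i + ((s * q : ℕ) : ZMod n))‖ ^ 2
      ≤ n * (2 * q * K ^ 2) := by
  simp_rw [highPart, sum_trigPoly_add, sum_norm_sq_trigPoly, norm_mul, mul_pow]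
  gcongr
  set w : ZMod n → ℝ := fun c => ‖if R < addOrderOf c then fourierCoef Φ c else 0‖ ^ 2
  have hw : ∀ (u : (ZMod n)ˣ) c, w ((u : ZMod n) ^ C * c) = w c := by
    intro u c
    simp only [w, fourierCoef_pow_mul hinv]
    rw [← Units.val_pow_eq_pow_val, addOrderOf_units_mul]
  have hw0 : ∀ c, 0 ≤ w c := fun c => by positivity
  have hwK : ∑ c, w c ≤ K ^ 2 := by
    refine le_trans (Finset.sum_le_sum fun c _ => ?_) (sum_norm_sq_fourierCoef_le hΦ)
    simp only [w]
    split_ifs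
    · exact le_rfl
    · simp
  have hφ : (0 : ℝ) < n.totient := by exact_mod_cast Nat.totient_pos.2 (NeZero.pos n)
  have hu : ∀ u : (ZMod n)ˣ, ∑ c, w c * ‖shiftKernel q ((u : ZMod n) ^ C * c)‖ ^ 2
      = ∑ c, w c * ‖shiftKernel q c‖ ^ 2 := by
    intro u
    refine Fintype.sum_equiv (Units.mulLeft (u ^ C)) _ _ fun c => ?_
    rw [Units.mulLeft_apply, Units.val_pow_eq_pow_val, hw]
  -- As w is invariant under u^C, the weighted sum equals its average over all units u, and only the
  -- mean square of the kernel along unit orbits enters.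
  refine le_of_mul_le_mul_left ?_ hφ
  calc (n.totient : ℝ) * ∑ c, w c * ‖shiftKernel q c‖ ^ 2
      = ∑ u : (ZMod n)ˣ, ∑ c, w c * ‖shiftKernel q ((u : ZMod n) ^ C * c)‖ ^ 2 := by
        rw [Finset.sum_congr rfl fun u _ => hu u, Finset.sum_const, Finset.card_univ,
          ZMod.card_units_eq_totient, nsmul_eq_mul]
    _ = ∑ c, w c * ∑ u : (ZMod n)ˣ, ‖shiftKernel q ((u : ZMod n) ^ C * c)‖ ^ 2 := by
        rw [Finset.sum_comm]
        simp_rw [Finset.mul_sum]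
    _ ≤ ∑ c, w c * (2 * q * n.totient) := by
        refine Finset.sum_le_sum fun c _ => ?_
        by_cases hc : R < addOrderOf c
        · exact mul_le_mul_of_nonneg_left (sum_units_norm_sq_shiftKernel_le hq hS c hc) (hw0 c)
        · simp [w, hc]
    _ ≤ K ^ 2 * (2 * q * n.totient) := by
        rw [← Finset.sum_mul]
        gcongr
    _ = _ := by ring

lemma sum_add_right {E : Type*} [AddCommMonoid E] (g : ZMod n → E) (a : ZMod n) :
    ∑ i, g (i + a) = ∑ i, g i :=
  Equiv.sum_comp (Equiv.addRight a) g

/-- Bounds the indices that wrap around modulo n under a shift, where the orbit gives no control. -/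
lemma card_le_val_add_le (m : ℕ) :
    (Finset.univ.filter fun i : ZMod n => n ≤ i.val + m).card ≤ m := by
  rw [← Nat.add_sub_cancel_left (n := n) (m := m), ← Nat.card_Ico n (n + m)]
  refine Finset.card_le_card_of_injOn (fun i => i.val + m) ?_ ?_
  · intro i hi
    have hi : n ≤ i.val + m := by simpa using hi
    have := i.val_lt
    simp only [Finset.coe_Ico, Set.mem_Ico]
    lia
  · intro i _ j _ hij
    exact ZMod.val_injective n (by simpa using hij)

/-- The high frequencies do not correlate with a function that is almost invariant under the shifts
by `s * q`, `s < q`. -/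
theorem norm_sum_highPart_mul_le {C q R : ℕ} (hq : 0 < q) {Φ F : ZMod n → ℂ} {K A η : ℝ}
    (hK : 0 ≤ K) (hη : 0 ≤ η) (hΦ : ∀ i, ‖Φ i‖ ≤ K)
    (hinv : ∀ (u : (ZMod n)ˣ) i, Φ ((u : ZMod n) ^ C * i) = Φ i)
    (hS : ∀ c : ZMod n, R < addOrderOf c → ∀ s < q, ∀ t < q, s ≠ t →
      ‖unitPowSum C (c * ((s * q : ℕ) : ZMod n) - c * ((t * q : ℕ) : ZMod n))‖ * q ≤ n.totient)
    (hF : ∀ i, ‖F i‖ ≤ A)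
    (hshift : ∀ s < q, ∀ i : ZMod n, i.val + s * q < n →
      ‖F (i + ((s * q : ℕ) : ZMod n)) - F i‖ ≤ η)
    (hqA : 2 * A ^ 2 ≤ q * η ^ 2) (hnA : 4 * A ^ 2 * q ^ 2 ≤ n * η ^ 2) :
    ‖∑ i, highPart R Φ i * F i‖ ≤ 3 * (K * η) * n := by
  set P := highPart R Φ
  have hq' : (0 : ℝ) < q := by exact_mod_cast hq
  have hn : (0 : ℝ) < n := by exact_mod_cast NeZero.pos n
  -- Translation invariance of the sum over ℤ/n gives q copies of it; replacing F(i + sq) by F(i)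
  -- leaves an averaged high part plus an error controlled by rigidity.
  have hid : (q : ℂ) * ∑ i, P i * F i
      = ∑ i, (∑ s ∈ Finset.range q, P (i + ((s * q : ℕ) : ZMod n))) * F i
        + ∑ s ∈ Finset.range q, ∑ i, P (i + ((s * q : ℕ) : ZMod n))
          * (F (i + ((s * q : ℕ) : ZMod n)) - F i) := by
    simp_rw [Finset.sum_mul]
    rw [Finset.sum_comm, ← Finset.sum_add_distrib]
    simp_rw [← Finset.sum_add_distrib, ← mul_add, add_sub_cancel]
    rw [Finset.sum_congr rfl (g := fun _ => ∑ i, P i * F i) fun s _ =>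
      sum_add_right (fun i => P i * F i) _]
    simp
  have h1 : ‖∑ i, (∑ s ∈ Finset.range q, P (i + ((s * q : ℕ) : ZMod n))) * F i‖
      ≤ q * (K * η * n) := by
    refine norm_sum_mul_le_of_sq_le _ _ _ (sum_norm_sq_sum_highPart_le hq hΦ hinv hS)
      (β := n * A ^ 2) ?_ (by positivity) ?_
    · calc _ ≤ ∑ _i : ZMod n, A ^ 2 := by gcongr with i; exact hF i
        _ = _ := by simp [ZMod.card]
    · calc n * (2 * q * K ^ 2) * (n * A ^ 2) = n ^ 2 * q * K ^ 2 * (2 * A ^ 2) := by ring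
        _ ≤ n ^ 2 * q * K ^ 2 * (q * η ^ 2) := by gcongr
        _ = _ := by ring
  have h2 : ∀ s ∈ Finset.range q, ‖∑ i, P (i + ((s * q : ℕ) : ZMod n))
      * (F (i + ((s * q : ℕ) : ZMod n)) - F i)‖ ≤ 2 * (K * η) * n := by
    intro s hs
    have hs := Finset.mem_range.1 hs
    -- One nη² comes from near-invariance; the other covers the at most q² wrapped indices, each
    -- costing at most 4A², through `hnA`.
    refine norm_sum_mul_le_of_sq_le _ _ _ (α := n * K ^ 2) (β := n * η ^ 2 + n * η ^ 2) ?_ ?_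
      (by positivity) ?_
    · rw [sum_add_right (fun i => ‖P i‖ ^ 2)]
      exact sum_norm_sq_highPart_le R hΦ
    · calc _ ≤ ∑ i : ZMod n, (η ^ 2 + if n ≤ i.val + s * q then (A + A) ^ 2 else 0) := by
            refine Finset.sum_le_sum fun i _ => ?_
            split_ifs with hi
            · refine le_add_of_nonneg_of_le (by positivity) ?_
              gcongr
              exact (norm_sub_le _ _).trans (add_le_add (hF _) (hF _))
            · rw [add_zero]
              gcongr
              exact hshift s hs i (not_le.1 hi)
        _ = n * η ^ 2 + (Finset.univ.filter fun i : ZMod n => n ≤ i.val + s * q).card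
              * (A + A) ^ 2 := by
            rw [Finset.sum_add_distrib, ← Finset.sum_filter, Finset.sum_const, Finset.sum_const]
            simp [ZMod.card]
        _ ≤ n * η ^ 2 + (q ^ 2 : ℝ) * (A + A) ^ 2 := by
            gcongr
            have : (Finset.univ.filter fun i : ZMod n => n ≤ i.val + s * q).card ≤ q ^ 2 :=
              (card_le_val_add_le _).trans (by rw [sq]; gcongr)
            exact_mod_cast this
        _ = n * η ^ 2 + 4 * A ^ 2 * q ^ 2 := by ring
        _ ≤ _ := by gcongr
    · nlinarith [sq_nonneg ((n : ℝ) * K * η)]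
  have h3 : ‖(q : ℂ) * ∑ i, P i * F i‖ ≤ q * (3 * (K * η) * n) := by
    rw [hid]
    calc _ ≤ q * (K * η * n) + ∑ s ∈ Finset.range q, 2 * (K * η) * n :=
          (norm_add_le _ _).trans (add_le_add h1 (norm_sum_le_of_le _ h2))
      _ = _ := by
          rw [Finset.sum_const, Finset.card_range, nsmul_eq_mul]
          ring
  rw [norm_mul, Complex.norm_natCast] at h3
  exact le_of_mul_le_mul_left h3 hq'

end PowerOrbit

/-! ### Choice of parameters and assembly. -/

namespace PowerOrbit

section Arithmetic

variable {n : ℕ} [NeZero n]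

lemma addOrderOf_le_mul_addOrderOf_nsmul {j : ℕ} (hj : 0 < j) (c : ZMod n) :
    addOrderOf c ≤ j * addOrderOf (j • c) := by
  refine Nat.le_of_dvd (Nat.mul_pos hj (addOrderOf_pos _)) ?_
  rw [addOrderOf_dvd_iff_nsmul_eq_zero, mul_comm, mul_nsmul', addOrderOf_nsmul_eq_zero]

/-- The difference is a nonzero multiple jc with |j| ≤ q², and multiplication by j lowers the order
by a factor of at most |j|. -/
lemma addOrderOf_le_mul_addOrderOf_sub {q s t : ℕ} (hs : s < q) (ht : t < q) (hst : s ≠ t)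
    (c : ZMod n) : addOrderOf c
      ≤ q ^ 2 * addOrderOf (c * ((s * q : ℕ) : ZMod n) - c * ((t * q : ℕ) : ZMod n)) := by
  wlog h : t < s generalizing s t
  · rw [← addOrderOf_neg (_ - _), neg_sub]
    exact this ht hs hst.symm (by lia)
  obtain ⟨d, hd, rfl⟩ : ∃ d, 0 < d ∧ s = t + d := ⟨s - t, by lia, by lia⟩
  have : c * (((t + d) * q : ℕ) : ZMod n) - c * ((t * q : ℕ) : ZMod n) = (d * q) • c := by
    rw [nsmul_eq_mul]
    push_cast
    ring
  rw [this]
  refine (addOrderOf_le_mul_addOrderOf_nsmul (Nat.mul_pos hd (by lia : 0 < q)) c).trans ?_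
  rw [sq]
  exact Nat.mul_le_mul_right _ (Nat.mul_le_mul_right _ (by lia))

open ArithmeticFunction in
-- In the threshold for R, one q² pays for the order lost on passing to the difference; the other q²
-- and (8C)^(2k) turn the square-root bound into a saving of q.
lemma norm_unitPowSum_sub_mul_le {C k q R : ℕ} (hC : 0 < C) (hk : cardDistinctFactors n ≤ k)
    (hR : q ^ 4 * (8 * C) ^ (2 * k) ≤ R) (c : ZMod n) (hc : R < addOrderOf c) {s t : ℕ}
    (hs : s < q) (ht : t < q) (hst : s ≠ t) :
    ‖unitPowSum C (c * ((s * q : ℕ) : ZMod n) - c * ((t * q : ℕ) : ZMod n))‖ * q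
      ≤ n.totient := by
  set c' := c * ((s * q : ℕ) : ZMod n) - c * ((t * q : ℕ) : ZMod n)
  have h1 : q ^ 4 * (8 * C) ^ (2 * k) ≤ q ^ 2 * addOrderOf c' :=
    (hR.trans hc.le).trans (addOrderOf_le_mul_addOrderOf_sub hs ht hst c)
  have h2 : q ^ 2 * (8 * C) ^ (2 * k) ≤ addOrderOf c' := by
    refine Nat.le_of_mul_le_mul_left (le_trans (le_of_eq ?_) h1) (pow_pos (by lia : 0 < q) 2)
    ring
  have h2' : (q : ℝ) ^ 2 * (8 * C) ^ (2 * k) ≤ addOrderOf c' := by exact_mod_cast h2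
  have h3 := norm_sq_unitPowSum_mul_addOrderOf_le hC hk c'
  have ho : (0 : ℝ) < addOrderOf c' := by exact_mod_cast addOrderOf_pos c'
  refine abs_le_of_sq_le_sq' ?_ (by positivity) |>.2
  refine le_of_mul_le_mul_right ?_ ho
  calc (‖unitPowSum C c'‖ * q) ^ 2 * addOrderOf c'
      = q ^ 2 * (‖unitPowSum C c'‖ ^ 2 * addOrderOf c') := by ring
    _ ≤ q ^ 2 * ((8 * C : ℝ) ^ k * n.totient) ^ 2 := by gcongr
    _ = n.totient ^ 2 * (q ^ 2 * (8 * C) ^ (2 * k)) := by ring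
    _ ≤ n.totient ^ 2 * addOrderOf c' := by gcongr

lemma sum_powCount_mul (C : ℕ) (F : ℕ → ℂ) :
    ∑ i ∈ Finset.range n, (powCount C n i : ℂ) * F i = ∑ t : ZMod n, F (t ^ C).val := by
  rw [sum_range_eq_sum_zmod]
  have h := sum_card_mul_eq_sum_comp C (fun _ : ZMod n => True) (fun x => F x.val)
  simp only [and_true, Finset.filter_true] at h
  rw [← h]
  refine Finset.sum_congr rfl fun x _ => ?_
  rw [powCount_eq_card, ZMod.natCast_zmod_val]

end Arithmetic

section Dynamics

variable {X : Type*} [MetricSpace X] [CompactSpace X]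

lemma dist_iterate_le_rigidityDefect (T : X → X) {q t : ℕ} (ht : t < q) (x : X) :
    dist x (T^[t * q] x) ≤ rigidityDefect T q := by
  have hb : ∀ t : ℕ, BddAbove (Set.range fun x : X => dist x (T^[t * q] x)) := fun t =>
    ⟨Metric.diam (Set.univ : Set X), by
      rintro _ ⟨y, rfl⟩
      exact Metric.dist_le_diam_of_mem isCompact_univ.isBounded trivial trivial⟩
  exact (le_ciSup (hb t) x).trans (le_ciSup
    (f := fun t : Fin q => ⨆ x : X, dist x (T^[(t : ℕ) * q] x))
    (Set.finite_range _).bddAbove ⟨t, ht⟩)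

/-- Along the rigidity times `q`, a continuous function is almost invariant under the iterates
`T^[s * q]`, `s < q`. -/
lemma exists_rigidity_time (T : X → X) {q : ℕ → ℕ} (hq : StrictMono q)
    (hrigid : Tendsto (fun j => rigidityDefect T (q j)) atTop (𝓝 0)) (f : C(X, ℂ)) {η : ℝ}
    (hη : 0 < η) (N : ℕ) :
    ∃ m, N ≤ m ∧ ∀ s < m, ∀ x, ‖f (T^[s * m] x) - f x‖ ≤ η := by
  obtain ⟨δ, hδ, hf⟩ := Metric.uniformContinuous_iff.1
    (CompactSpace.uniformContinuous_of_continuous f.continuous) η hη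
  obtain ⟨j, hj, hjN⟩ := ((hrigid.eventually_lt_const hδ).and
    (hq.tendsto_atTop.eventually_ge_atTop N)).exists
  refine ⟨q j, hjN, fun s hs x => ?_⟩
  have := hf ((dist_iterate_le_rigidityDefect T hs x).trans_lt hj)
  rw [dist_comm, dist_eq_norm] at this
  exact this.le

variable [MeasurableSpace X] [BorelSpace X]

open ArithmeticFunction in
/-- Equidistribution along `C`-th powers for functions of mean zero. -/
theorem eventually_norm_sum_powCount_le {T : X → X} (hTc : Continuous T)
    (hT : TotallyUniquelyErgodic T) {C : ℕ} (hC : 0 < C) (k : ℕ) {q : ℕ → ℕ} (hq : StrictMono q)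
    (hrigid : Tendsto (fun j => rigidityDefect T (q j)) atTop (𝓝 0))
    (μ : Measure X) [IsProbabilityMeasure μ] (hμ : MeasurePreserving T μ μ) (f : C(X, ℂ))
    (hf : ∫ y, f y ∂μ = 0) {ε : ℝ} (hε : 0 < ε) :
    ∀ᶠ n : ℕ in atTop, cardDistinctFactors n ≤ k → ∀ x : X,
      ‖∑ i ∈ Finset.range n, (powCount C n i : ℂ) * f (T^[i] x)‖ ≤ ε * n := by
  set A : ℝ := ‖f‖
  have hfA : ∀ y, ‖f y‖ ≤ A := f.norm_coe_le_norm
  -- This L makes the discarded residues, at most kn/L of them, cost at most εn/4.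
  obtain ⟨L, hL0, hL⟩ : ∃ L : ℕ, 0 < L ∧ A * k ≤ ε / 4 * L := by
    obtain ⟨L, hL⟩ := exists_nat_ge (A * k / (ε / 4))
    refine ⟨L + 1, L.succ_pos, ?_⟩
    rw [div_le_iff₀ (by positivity)] at hL
    push_cast
    linarith
  set B := L ^ k
  set K : ℕ := B * ((4 * C) ^ k * B ^ C)
  have hK : 0 < K := by positivity
  have hK' : (0 : ℝ) < K := by exact_mod_cast hK
  -- The high-frequency bound 3Kηn then equals εn/4.
  set η : ℝ := ε / (12 * K)
  have hη : 0 < η := by positivity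
  obtain ⟨Q, hQ⟩ := exists_nat_ge (2 * A ^ 2 / η ^ 2)
  obtain ⟨m, hQm, hm⟩ := exists_rigidity_time T hq hrigid f hη (Q + 1)
  have hm0 : 0 < m := by lia
  have hmA : 2 * A ^ 2 ≤ m * η ^ 2 := by
    rw [div_le_iff₀ (by positivity)] at hQ
    refine hQ.trans ?_
    gcongr
    lia
  set R : ℕ := m ^ 4 * (8 * C) ^ (2 * k)
  have hR0 : (0 : ℝ) < R.factorial := by exact_mod_cast Nat.factorial_pos R
  have hlow := hT.eventually_norm_periodic_sum_le hTc μ hμ f hf (Nat.factorial_pos R)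
    (mul_pos hR0 hK') (show 0 < ε / 4 by positivity)
  have hlarge : ∀ᶠ n : ℕ in atTop, 4 * A ^ 2 * m ^ 2 ≤ n * η ^ 2 :=
    ((tendsto_natCast_atTop_atTop (R := ℝ)).atTop_mul_const (by positivity)).eventually_ge_atTop _
  filter_upwards [hlow, hlarge, eventually_gt_atTop 0] with n hn1 hn2 hn0 hk x
  have : NeZero n := ⟨hn0.ne'⟩
  set F : ZMod n → ℂ := fun i => f (T^[i.val] x)
  have hF : ∀ i, ‖F i‖ ≤ A := fun i => hfA _
  set Φ : ZMod n → ℂ := fun i => (tameCount C B i : ℂ)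
  have hΦ : ∀ i, ‖Φ i‖ ≤ K := fun i => by
    simp only [Φ, Complex.norm_natCast]
    exact_mod_cast tameCount_le B hC hk i
  have hinv : ∀ (u : (ZMod n)ˣ) i, Φ ((u : ZMod n) ^ C * i) = Φ i := fun u i => by
    simp only [Φ, tameCount_pow_mul]
  have hsplit : ∑ i ∈ Finset.range n, (powCount C n i : ℂ) * f (T^[i] x)
      = ∑ i, lowPart R Φ i * F i + ∑ i, highPart R Φ i * F i
        + ∑ t ∈ Finset.univ.filter fun t : ZMod n => ¬ n ≤ B * addOrderOf t, F (t ^ C) := by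
    rw [sum_powCount_mul C fun i => f (T^[i] x), ← Finset.sum_add_distrib]
    simp_rw [← add_mul, lowPart_add_highPart]
    rw [show ∑ i, Φ i * F i = _ from sum_card_mul_eq_sum_comp C _ F,
      Finset.sum_filter_add_sum_filter_not]
  have h1 : ‖∑ i, lowPart R Φ i * F i‖ ≤ ε / 4 * n := by
    have h := hn1 x (fun i => lowPart R Φ i)
      (fun i => by rw [Nat.cast_add, lowPart_add_factorial])
      (fun i => norm_lowPart_le R hK'.le hΦ _)
    rw [sum_range_eq_sum_zmod] at h
    simpa only [ZMod.natCast_zmod_val] using h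
  have h2 : ‖∑ i, highPart R Φ i * F i‖ ≤ ε / 4 * n := by
    have h := norm_sum_highPart_mul_le hm0 hK'.le hη.le hΦ hinv
      (fun c hc s hs t ht hst => norm_unitPowSum_sub_mul_le hC hk le_rfl c hc hs ht hst) hF
      (fun s hs i hi => ?_) hmA hn2
    · refine h.trans (le_of_eq ?_)
      simp only [η]
      field_simp
      norm_num
    -- Without wrap-around, the shift in ℤ/n is a genuine application of T^(sm), so the rigidity
    -- estimate applies.
    · have hval : (i + ((s * m : ℕ) : ZMod n)).val = s * m + i.val := by
        rw [ZMod.val_add, ZMod.val_natCast, Nat.add_mod_mod, Nat.mod_eq_of_lt hi, add_comm]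
      simp only [F, hval, Function.iterate_add_apply]
      exact hm s hs _
  have h3 : ‖∑ t ∈ Finset.univ.filter fun t : ZMod n => ¬ n ≤ B * addOrderOf t, F (t ^ C)‖
      ≤ ε / 4 * n := by
    have hc : ((Finset.univ.filter fun t : ZMod n => ¬ n ≤ B * addOrderOf t).card : ℝ) * L
        ≤ k * n := by exact_mod_cast card_not_tame_mul_le hL0 hk
    refine (norm_sum_le_of_le _ fun t _ => hF (t ^ C)).trans ?_
    rw [Finset.sum_const, nsmul_eq_mul]
    have hL' : (0 : ℝ) < L := by exact_mod_cast hL0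
    refine le_of_mul_le_mul_right ?_ hL'
    calc _ = _ * (L : ℝ) * A := by ring
      _ ≤ k * n * A := by gcongr
      _ = A * k * n := by ring
      _ ≤ ε / 4 * L * n := by gcongr
      _ = _ := by ring
  rw [hsplit]
  have hnn : (0 : ℝ) ≤ ε * n := by positivity
  calc _ ≤ ε / 4 * n + ε / 4 * n + ε / 4 * n :=
        (norm_add_le _ _).trans (add_le_add ((norm_add_le _ _).trans (add_le_add h1 h2)) h3)
    _ ≤ ε * n := by linarith

end Dynamics

end PowerOrbit

theorem theorem1p2 {X : Type*} [MetricSpace X] [CompactSpace X] [MeasurableSpace X]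
    [BorelSpace X] (T : X ≃ₜ X) (hT : PowerOrbit.TotallyUniquelyErgodic T)
    (C : ℕ) (hC : 2 ≤ C) (k : ℕ) (q : ℕ → ℕ) (hq : StrictMono q)
    (hrigid : Tendsto (fun n : ℕ => PowerOrbit.rigidityDefect T (q n)) atTop (𝓝 0))
    (μ : Measure X) [IsProbabilityMeasure μ] (hμ : MeasurePreserving T μ μ)
    (f : C(X, ℂ)) :
    TendstoUniformly
      (fun (n : ℕ) (x : X) =>
        (1 / (n : ℂ)) * ∑ i ∈ Finset.range n, (PowerOrbit.powCount C n i : ℂ) * f (T^[i] x))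
      (fun _ : X => ∫ y, f y ∂μ)
      (atTop ⊓ 𝓟 {n : ℕ | ArithmeticFunction.cardDistinctFactors n ≤ k}) := by
  set I := ∫ y, f y ∂μ
  have hfint : Integrable f μ := f.continuous.integrable_of_hasCompactSupport
    (HasCompactSupport.of_compactSpace f)
  have hf0 : ∫ y, (f - ContinuousMap.const X I) y ∂μ = 0 := by
    simp only [ContinuousMap.sub_apply, ContinuousMap.const_apply]
    rw [integral_sub hfint (integrable_const I)]
    simp [I]
  rw [Metric.tendstoUniformly_iff]
  intro ε hε
  rw [eventually_inf_principal]
  filter_upwards [PowerOrbit.eventually_norm_sum_powCount_le T.continuous hT (by lia : 0 < C) k hq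
    hrigid μ hμ _ hf0 (half_pos hε), eventually_gt_atTop 0] with n hn hn0 hk x
  have : NeZero n := ⟨hn0.ne'⟩
  have hn' : (0 : ℝ) < n := by exact_mod_cast hn0
  have hnC : (n : ℂ) ≠ 0 := by exact_mod_cast hn0.ne'
  -- The weights have total mass n, so replacing f by f minus its mean subtracts exactly n times the
  -- integral.
  have hone : ∑ i ∈ Finset.range n, (PowerOrbit.powCount C n i : ℂ) = n := by
    have h := PowerOrbit.sum_powCount_mul (n := n) C fun _ => 1
    simpa [ZMod.card] using h
  have h := hn hk x
  simp only [ContinuousMap.sub_apply, ContinuousMap.const_apply, mul_sub, Finset.sum_sub_distrib,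
    ← Finset.sum_mul] at h
  rw [hone] at h
  rw [dist_comm, dist_eq_norm]
  have heq : (1 / (n : ℂ)) * ∑ i ∈ Finset.range n, (PowerOrbit.powCount C n i : ℂ) * f (T^[i] x) - I
      = (n : ℂ)⁻¹ * (∑ i ∈ Finset.range n, (PowerOrbit.powCount C n i : ℂ) * f (T^[i] x) - n * I) := by
    field_simp
  rw [heq, norm_mul, norm_inv, Complex.norm_natCast, inv_mul_lt_iff₀ hn']
  nlinarith
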